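/- Fix a field $K$. All quivers are finite. For an arrow $a$ write $ta$ and $ha$ for its tail and head. A rooted tree quiver $(Q,\sigma)$ is a quiver whose underlying graph is a tree and which has a unique sink $\sigma$ (its root). A representation of a quiver is finite-dimensional over $K$. A quiver over $Q$ is a quiver $\Lambda$ with a map of directed graphs $\lambda\colon\Lambda\to Q$ (vertices to vertices, arrows to arrows, compatibly with heads and tails); $\operatorname{Hom}_{\downarrow Q}(\Lambda,\Gamma)$ is the set of maps of directed graphs $f\colon\Lambda\to\Gamma$ with $\gamma f=\lambda$. For a quiver $\Lambda\xrightarrow{\lambda}Q$ over $Q$ and a representation $V$ of $\Lambda$, the pushforward $\lambda_*V$ is the representation of $Q$ with $(\lambda_*V)_x=\bigoplus_{y\in\lambda^{-1}(x)}V_y$ and $(\lambda_*V)_a=\sum_{b\in\lambda^{-1}(a)}V_b$ (with $V_b$ extended by zero to the other summands). $\mathbb 1_\Lambda$ is the representation with $K$ at every vertex and the identity over every arrow; $\lambda_*\mathbb 1_\Lambda$ has a standard basis $\{v_y\}$ indexed by the vertices $y$ of $\Lambda$. Let $Q$ be a rooted tree quiver. For each vertex $x$ define recursively the finite poset $L_{Q,x}=\prod_{a\colon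 y\to x}J(L_{Q,y})$, the product over all arrows $a$ with head $x$ (one element if there is none), where $J(A)$ is the set of order ideals (down-sets, including $\emptyset$) of $A$ ordered by inclusion, and the product is ordered componentwise. For $M=(M_a)_a\in L_{Q,x}$ define recursively a quiver $c_M\colon Q_M\to Q$ over $Q$ with a root $\sigma_M$, $c_M(\sigma_M)=x$: for each arrow $a\colon y\to x$ and each maximal element $S$ of $M_a\subseteq L_{Q,y}$, extend $Q_S$ by one new vertex (lying over $x$) and one arrow (lying over $a$) from $\sigma_S$ to it; $Q_M$ is obtained by identifying all these new vertices to one vertex $\sigma_M$ (and is the single vertex $\sigma_M$ if there are none). Put $\mathbb 1_M=(c_M)_*\mathbb 1_{Q_M}$, and for $M,N\in L_{Q,x}$ let $$\overline{\operatorname{Hom}}_Q(\mathbb 1_M,\mathbb 1_N)=\operatorname{Hom}_Q(\mathbb 1_M,\mathbb 1_N)/\{f\mid f_x=0\}$$ be the stable hom space. **Theorem.** Let $\Lambda\xrightarrow{\lambda}Q$ and $\Gamma\xrightarrow{\gamma}Q$ be rooted tree quivers over $Q$, with roots $\sigma_\Lambda,\sigma_\Gamma$ and standard bases $\{v_y\}$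 of $\lambda_*\mathbb 1_\Lambda$ and $\{w_z\}$ of $\gamma_*\mathbb 1_\Gamma$. If $f\in\operatorname{Hom}_{\downarrow Q}(\Lambda,\Gamma)$ is root preserving, i.e. $f(\sigma_\Lambda)=\sigma_\Gamma$, then $\lambda(\sigma_\Lambda)=\gamma(\sigma_\Gamma)=:x$, the assignment $v_y\mapsto w_{f(y)}$ defines a morphism $\tilde f\colon\lambda_*\mathbb 1_\Lambda\to\gamma_*\mathbb 1_\Gamma$ of representations of $Q$, and $\tilde f_x\ne0$. For every vertex $x$ of $Q$ and all $M,N\in L_{Q,x}$, every $f\in\operatorname{Hom}_{\downarrow Q}(Q_M,Q_N)$ induces in the same way a morphism $\tilde f\colon\mathbb 1_M\to\mathbb 1_N$, and the linear map from the free vector space $$K\langle\operatorname{Hom}_{\downarrow Q}(Q_M,Q_N)\rangle\longrightarrow\overline{\operatorname{Hom}}_Q(\mathbb 1_M,\mathbb 1_N),\qquad f\mapsto[\tilde f],$$ is surjective. In particular $\overline{\operatorname{Hom}}_Q(\mathbb 1_M,\mathbb 1_N)\neq0$ if and only if $M\le N$. -/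

import Mathlib

noncomputable section

namespace QuiverOver

open scoped Classical DirectSum

universe u v u' v' w w'

/-! ### Finite quivers, rooted tree quivers, quivers over `Q` -/

/-- A quiver with finitely many vertices and finitely many arrows. -/
class FiniteQuiver (Q : Type u) [Quiver.{v} Q] : Prop where
  finite_vertices : Finite Q
  finite_arrows : ∀ x y : Q, Finite (x ⟶ y)

attribute [instance] FiniteQuiver.finite_vertices FiniteQuiver.finite_arrows

/-- The relation "there is an arrow `y ⟶ x`" (as a relation between `y` and `x`). -/
def ArrowRel (Q : Type u) [Quiver.{v} Q] (y x : Q) : Prop := Nonempty (y ⟶ x)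

/-- A rooted tree quiver with root `σ`: the underlying (unoriented multi-)graph is a tree, and `σ` is
the unique sink. The underlying multigraph is a tree iff it has neither loops nor multiple edges
(`edge_unique`) and the simple graph it defines is connected and has no cycles. -/
structure IsRootedTree (Q : Type u) [Quiver.{v} Q] (σ : Q) : Prop where
  edge_unique : ∀ x y : Q, Subsingleton ((x ⟶ y) ⊕ (y ⟶ x))
  isTree : (SimpleGraph.fromRel (ArrowRel Q)).IsTree
  sink_iff : ∀ x : Q, (∀ y : Q, IsEmpty (x ⟶ y)) ↔ x = σ

/-- `Hom_{↓Q}(Λ, Γ)`: the maps of directed graphs commuting with the structure maps to `Q`. -/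
def OverHom {Q : Type*} [Quiver Q] {Λ : Type*} [Quiver Λ] {Γ : Type*} [Quiver Γ]
    (lam : Λ ⥤q Q) (gam : Γ ⥤q Q) : Type _ :=
  {f : Λ ⥤q Γ // f ⋙q gam = lam}

/-! ### Representations -/

/-- A (finite-dimensional) representation of the quiver `Q` over the field `K`. -/
structure Rep (K : Type w) [Field K] (Q : Type u) [Quiver.{v} Q] where
  obj : Q → Type w'
  [addCommGroup : ∀ x, AddCommGroup (obj x)]
  [module : ∀ x, Module K (obj x)]
  [finite : ∀ x, Module.Finite K (obj x)]
  map : ∀ {x y : Q}, (x ⟶ y) → obj x →ₗ[K] obj y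

attribute [instance] Rep.addCommGroup Rep.module Rep.finite

section Hom

variable {K : Type*} [Field K] {Q : Type*} [Quiver Q]

/-- The vector space `Hom_Q(V, W)` of morphisms of representations: families of linear maps, one for
each vertex, that commute with the maps over all arrows. -/
def RepHom (V W : Rep K Q) : Submodule K (∀ x : Q, V.obj x →ₗ[K] W.obj x) where
  carrier := {φ | ∀ (x y : Q) (a : x ⟶ y), W.map a ∘ₗ φ x = φ y ∘ₗ V.map a}
  add_mem' := by
    intro φ ψ hφ hψ x y a
    simp only [Pi.add_apply, LinearMap.comp_add, LinearMap.add_comp, hφ x y a, hψ x y a]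
  zero_mem' := by
    intro x y a
    simp
  smul_mem' := by
    intro c φ hφ x y a
    simp only [Pi.smul_apply, LinearMap.comp_smul, LinearMap.smul_comp, hφ x y a]

/-- The subspace `{f | f_x = 0}` of `Hom_Q(V, W)`. -/
def vanishingAt (V W : Rep K Q) (x : Q) : Submodule K (RepHom V W) :=
  LinearMap.ker ((LinearMap.proj x : (∀ z : Q, V.obj z →ₗ[K] W.obj z) →ₗ[K] _) ∘ₗ
    (RepHom V W).subtype)

/-- The stable hom space at the vertex `x`: `Hom_Q(V, W) / {f | f_x = 0}`. -/
abbrev StableHom (V W : Rep K Q) (x : Q) : Type _ := RepHom V W ⧸ vanishingAt V W x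

end Hom

/-- The identity representation: `K` at every vertex, the identity over every arrow. -/
abbrev Rep.one (K : Type w) [Field K] (Q : Type u) [Quiver.{v} Q] : Rep.{u, v, w, w} K Q where
  obj _ := K
  map _ := LinearMap.id

section Pushforward

variable {Q : Type u} [Quiver.{v} Q] {Λ : Type u'} [Quiver.{v'} Λ]

/-- The vertices of `Λ` over `x`. -/
abbrev VertexFiber (c : Λ ⥤q Q) (x : Q) : Type _ := {y : Λ // c.obj y = x}

/-- The arrows of `Λ` over the arrow `a`. -/
structure ArrowFiber (c : Λ ⥤q Q) {s t : Q} (a : s ⟶ t) where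
  tail : VertexFiber c s
  head : VertexFiber c t
  arrow : tail.1 ⟶ head.1
  liesOver : Quiver.Hom.cast tail.2 head.2 (c.map arrow) = a

instance [FiniteQuiver Λ] (c : Λ ⥤q Q) {s t : Q} (a : s ⟶ t) : Finite (ArrowFiber c a) := by
  refine Finite.of_injective
    (β := Σ p : VertexFiber c s × VertexFiber c t, (p.1.1 ⟶ p.2.1))
    (fun b => ⟨(b.tail, b.head), b.arrow⟩) ?_
  rintro ⟨s₁, t₁, b₁, h₁⟩ ⟨s₂, t₂, b₂, h₂⟩ h
  simp only [Sigma.mk.injEq, Prod.mk.injEq] at h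
  obtain ⟨⟨rfl, rfl⟩, h⟩ := h
  obtain rfl := eq_of_heq h
  rfl

instance [FiniteQuiver Λ] (c : Λ ⥤q Q) {s t : Q} (a : s ⟶ t) : Fintype (ArrowFiber c a) :=
  Fintype.ofFinite _

/-- The pushforward `c_* V`, with `(c_* V)_x = ⨁_{y ∈ c⁻¹(x)} V_y` and
`(c_* V)_a = ∑_{b ∈ c⁻¹(a)} V_b`, where `V_b` is extended by zero to the other summands. -/
abbrev pushforward {K : Type w} [Field K] [FiniteQuiver Λ] (c : Λ ⥤q Q)
    (V : Rep.{u', v', w, w'} K Λ) : Rep.{u, v, w, max u' w'} K Q where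
  obj x := ⨁ y : VertexFiber c x, V.obj y.1
  finite x := inferInstanceAs (Module.Finite K (Π₀ y : VertexFiber c x, V.obj y.1))
  map {s t} a := ∑ b : ArrowFiber c a,
    DirectSum.lof K (VertexFiber c t) (fun y => V.obj y.1) b.head ∘ₗ V.map b.arrow ∘ₗ
      DirectSum.component K (VertexFiber c s) (fun y => V.obj y.1) b.tail

/-- The representation `c_* 𝟙_Λ` of `Q`. -/
abbrev pushOne (K : Type w) [Field K] [FiniteQuiver Λ] (c : Λ ⥤q Q) : Rep K Q :=
  pushforward c (Rep.one K Λ)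

/-- The standard basis vector `v_y` of `c_* 𝟙_Λ` at the vertex `x`, for a vertex `y` over `x`. -/
def stdVec (K : Type w) [Field K] [FiniteQuiver Λ] (c : Λ ⥤q Q) {x : Q} (y : VertexFiber c x) :
    (pushOne K c).obj x :=
  DirectSum.lof K (VertexFiber c x) (fun _ => K) y 1

/-- A map of quivers over `Q` maps the fibre over `x` to the fibre over `x`. -/
def OverHom.onFiber {Γ : Type*} [Quiver Γ] {lam : Λ ⥤q Q} {gam : Γ ⥤q Q} (f : OverHom lam gam)
    {x : Q} (y : VertexFiber lam x) : VertexFiber gam x :=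
  ⟨f.1.obj y.1, (congrArg (fun F : Λ ⥤q Q => F.obj y.1) f.2).trans y.2⟩

/-- The family of linear maps `f̃_x : (λ_* 𝟙_Λ)_x → (γ_* 𝟙_Γ)_x`, `v_y ↦ w_{f(y)}`, induced by a map
`f : Λ → Γ` of quivers over `Q`. -/
def OverHom.induced (K : Type w) [Field K] [FiniteQuiver Λ] {Γ : Type*} [Quiver Γ] [FiniteQuiver Γ]
    {lam : Λ ⥤q Q} {gam : Γ ⥤q Q} (f : OverHom lam gam) (x : Q) :
    (pushOne K lam).obj x →ₗ[K] (pushOne K gam).obj x :=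
  DirectSum.toModule K (VertexFiber lam x) _
    (fun y => LinearMap.toSpanSingleton K ((pushOne K gam).obj x) (stdVec K gam (f.onFiber y)))

end Pushforward

/-! ### The lattices `L_{Q,x}` -/

/-- In a finite rooted tree quiver, one can do recursion on the vertices along arrows. -/
theorem IsRootedTree.acc {Q : Type u} [Quiver.{v} Q] [FiniteQuiver Q] {σ : Q}
    (hQ : IsRootedTree Q σ) (x : Q) : Acc (ArrowRel Q) x := by
  have hno : ∀ x y : Q, ArrowRel Q x y → ¬ ArrowRel Q y x := by
    rintro x y ⟨a⟩ ⟨b⟩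
    have := hQ.edge_unique x y
    exact Sum.inl_ne_inr (Subsingleton.elim (Sum.inl a : (x ⟶ y) ⊕ (y ⟶ x)) (Sum.inr b))
  have hadj : ∀ x y : Q, ArrowRel Q x y → (SimpleGraph.fromRel (ArrowRel Q)).Adj x y := by
    intro x y h
    rw [SimpleGraph.fromRel_adj]
    exact ⟨fun e => hno x y h (e ▸ h), Or.inl h⟩
  have hcyc : ∀ y : Q, ¬ Relation.TransGen (ArrowRel Q) y y := by
    intro y hy
    obtain ⟨x, hyx, hxy⟩ := Relation.TransGen.head'_iff.1 hy
    have hbr := SimpleGraph.isAcyclic_iff_forall_adj_isBridge.1 hQ.isTree.isAcyclic (hadj y x hyx)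
    rw [SimpleGraph.isBridge_iff] at hbr
    have key : ∀ z, Relation.ReflTransGen (ArrowRel Q) x z →
        ((SimpleGraph.fromRel (ArrowRel Q)).deleteEdges {s(y, x)}).Reachable x z := by
      intro z hz
      induction hz with
      | refl => exact SimpleGraph.Reachable.refl _
      | @tail z w _ hzw ih =>
        by_cases he : s(z, w) = s(y, x)
        · rcases Sym2.eq_iff.1 he with ⟨rfl, rfl⟩ | ⟨rfl, rfl⟩
          · exact absurd ih.symm hbr
          · exact absurd hzw (hno _ _ hyx)
        · refine ih.trans (SimpleGraph.Adj.reachable ?_)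
          rw [SimpleGraph.deleteEdges_adj]
          exact ⟨hadj z w hzw, he⟩
    exact hbr (key y hxy).symm
  have : Std.Irrefl (Relation.TransGen (ArrowRel Q)) := ⟨hcyc⟩
  have hwf : WellFounded (Relation.TransGen (ArrowRel Q)) :=
    Finite.wellFounded_of_trans_of_irrefl _
  exact (Subrelation.wf (fun h => Relation.TransGen.single h) hwf).apply x

section Lattice

variable {Q : Type u} [Quiver.{v} Q]

/-- Recursive construction of the poset `L_{Q,x} = ∏_{a : y ⟶ x} J(L_{Q,y})`, where `J` is the
poset of order ideals (including the empty one) ordered by inclusion and products carry the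
componentwise order. Removing `x` from the subquiver of all vertices with a path to `x` leaves the
rooted trees formed by the vertices with a path to `y`, one for each arrow `a : y ⟶ x`. -/
def lattAux {x : Q} (h : Acc (ArrowRel Q) x) : PartOrd.{max u v} :=
  Acc.rec (motive := fun _ _ => PartOrd.{max u v})
    (fun x _ L => PartOrd.of (∀ p : (Σ y : Q, (y ⟶ x)), LowerSet (L p.1 ⟨p.2⟩))) h

theorem lattAux_intro {x : Q} (h : ∀ y, ArrowRel Q y x → Acc (ArrowRel Q) y) :
    lattAux (Acc.intro x h) =
      PartOrd.of (∀ p : (Σ y : Q, (y ⟶ x)), LowerSet (lattAux (h p.1 ⟨p.2⟩))) := rfl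

instance finite_lattAux [FiniteQuiver Q] {x : Q} (h : Acc (ArrowRel Q) x) :
    Finite (lattAux h) := by
  induction h with
  | intro x h ih =>
    have : ∀ p : (Σ y : Q, (y ⟶ x)), Finite (LowerSet (lattAux (h p.1 ⟨p.2⟩))) := fun p =>
      have := ih p.1 ⟨p.2⟩
      Finite.of_injective
        (SetLike.coe : LowerSet (lattAux (h p.1 ⟨p.2⟩)) → Set (lattAux (h p.1 ⟨p.2⟩)))
        SetLike.coe_injective
    exact inferInstanceAs
      (Finite (∀ p : (Σ y : Q, (y ⟶ x)), LowerSet (lattAux (h p.1 ⟨p.2⟩))))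

/-- The finite poset (a distributive lattice) `L_{Q,x}` of a rooted tree quiver `Q`. -/
abbrev Latt [FiniteQuiver Q] {σ : Q} (hQ : IsRootedTree Q σ) (x : Q) : PartOrd.{max u v} :=
  lattAux (hQ.acc x)

end Lattice

/-! ### The reduced quivers `Q_M` over `Q` -/

/-- A finite quiver over `Q` with a distinguished vertex `root` lying over the vertex `x`. -/
structure PointedOver (Q : Type u) [Quiver.{v} Q] (x : Q) where
  V : Type (max u v)
  [quiver : Quiver.{max u v} V]
  [finite : FiniteQuiver V]
  root : V
  str : V ⥤q Q
  str_root : str.obj root = x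

attribute [instance] PointedOver.quiver PointedOver.finite

section Glue

/-- The arrows of the quiver obtained from a family of quivers `V i` with distinguished vertices
`r i` by adding one new vertex `none` and an arrow from each `r i` to it. -/
inductive GlueHom {ι : Type w} (V : ι → Type w) [∀ i, Quiver.{w} (V i)] (r : ∀ i, V i) :
    Option (Σ i, V i) → Option (Σ i, V i) → Type w
  | incl (i : ι) {y z : V i} (e : y ⟶ z) : GlueHom V r (some ⟨i, y⟩) (some ⟨i, z⟩)
  | toRoot (i : ι) : GlueHom V r (some ⟨i, r i⟩) none

theorem finite_glueHom {ι : Type w} [Finite ι] (V : ι → Type w) [∀ i, Quiver.{w} (V i)]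
    (r : ∀ i, V i) [∀ i, FiniteQuiver (V i)] (p q : Option (Σ i, V i)) :
    Finite (GlueHom V r p q) := by
  refine Finite.of_injective (β := Option (Σ (i : ι) (y z : V i), (y ⟶ z)))
    (fun e => match e with
      | .incl i e => some ⟨i, _, _, e⟩
      | .toRoot _ => none) ?_
  intro e e' h
  cases e with
  | incl i e =>
    cases e' with
    | incl _ e' => simpa using h
  | toRoot i =>
    cases e'
    rfl

variable {Q : Type u} [Quiver.{v} Q]

/-- Given quivers `F i` over `Q` with root over `y i`, and arrows `a i : y i ⟶ x`, take the one-point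
extension of each `F i` from its root by an arrow over `a i`, and glue all of these at their new
roots. For an empty family this is the single vertex `x`. -/
def glue {x : Q} {ι : Type (max u v)} [Finite ι] {y : ι → Q} (a : ∀ i, y i ⟶ x)
    (F : ∀ i, PointedOver Q (y i)) : PointedOver Q x :=
  letI : Quiver.{max u v} (Option (Σ i, (F i).V)) :=
    ⟨GlueHom (fun i => (F i).V) (fun i => (F i).root)⟩
  { V := Option (Σ i, (F i).V)
    finite := ⟨inferInstance, finite_glueHom _ _⟩
    root := none
    str :=
      { obj := fun p => match p with
          | none => x
          | some ⟨i, z⟩ => (F i).str.obj z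
        map := fun e => match e with
          | .incl i e => (F i).str.map e
          | .toRoot i => Quiver.Hom.cast (F i).str_root.symm rfl (a i) }
    str_root := rfl }

/-- Recursive construction of the reduced quiver `c_M : Q_M → Q` for `M ∈ L_{Q,x}`: writing
`M = (M_a)_{a : y ⟶ x}` with ideals `M_a ⊆ L_{Q,y}`, extend each `Q_S`, `S ∈ max(M_a)`, by an arrow
over `a`, and glue all of these at their new roots. -/
def reducedAux [FiniteQuiver Q] {x : Q} (h : Acc (ArrowRel Q) x) :
    lattAux h → PointedOver Q x :=
  Acc.rec (motive := fun x h => lattAux h → PointedOver Q x)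
    (fun x h R (M : ∀ p : (Σ y : Q, (y ⟶ x)), LowerSet (lattAux (h p.1 ⟨p.2⟩))) =>
      glue (ι := Σ p : (Σ y : Q, (y ⟶ x)),
          {S : lattAux (h p.1 ⟨p.2⟩) // Maximal (fun T => T ∈ M p) S})
        (fun i => i.1.2) (fun i => R i.1.1 ⟨i.1.2⟩ i.2.1)) h

theorem reducedAux_intro [FiniteQuiver Q] {x : Q} (h : ∀ y, ArrowRel Q y x → Acc (ArrowRel Q) y)
    (M : ∀ p : (Σ y : Q, (y ⟶ x)), LowerSet (lattAux (h p.1 ⟨p.2⟩))) :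
    reducedAux (Acc.intro x h) M =
      glue (ι := Σ p : (Σ y : Q, (y ⟶ x)),
          {S : lattAux (h p.1 ⟨p.2⟩) // Maximal (fun T => T ∈ M p) S})
        (fun i => i.1.2) (fun i => reducedAux (h i.1.1 ⟨i.1.2⟩) i.2.1) := rfl

variable [FiniteQuiver Q] {σ : Q} {hQ : IsRootedTree Q σ} {x : Q}

/-- The reduced quiver `Q_M` over `Q`, with root `σ_M`. -/
abbrev reducedQuiver (M : Latt hQ x) : PointedOver Q x := reducedAux (hQ.acc x) M

/-- The structure map `c_M : Q_M → Q`. -/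
abbrev reducedStr (M : Latt hQ x) : (reducedQuiver M).V ⥤q Q := (reducedQuiver M).str

/-- The reduced representation `𝟙_M = (c_M)_* 𝟙_{Q_M}` of `Q`. -/
abbrev reducedRep (K : Type w) [Field K] (M : Latt hQ x) : Rep K Q := pushOne K (reducedStr M)

end Glue

end QuiverOver

end

noncomputable section

namespace QuiverOver

open scoped Classical DirectSum

universe u v u' v' w w'

/-! ### Arrows out of a vertex -/

/-! In a rooted tree quiver, and in each $Q_M$, at most one arrow leaves a vertex. Hence
$(\lambda_*\mathbb 1)_a$ sends $v_y$ to $v_{y'}$ if an arrow $y\to y'$ lies over $a$, and to $0$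
otherwise. So $v_y\mapsto w_{f(y)}$ is a morphism as soon as $f$ sends sinks to sinks.

The root is the only vertex of $Q_M$ over $x$ (`eq_root_of_str_obj_eq`), so the space of $\mathbb
1_M$ at $x$ is a line. Therefore the stable hom space has dimension at most one, every map over $Q$
preserves roots, and any single $\tilde f$ spans. It remains to see that a nonzero class forces some
$f$ to exist.

Let $\varphi_x\ne0$. Comparing $\varphi(v_{y'})$ with the image of $\varphi(v_y)$ along an arrow
$y\to y'$ shows that the support of $\varphi$ lifts arrows backwards: it is a simulation relating
the two roots (`isSimulation_of_mem_repHom`). By induction along $Q$ such a simulation gives $M\le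
N$ (`le_of_isSimulation`), and $M\le N$ gives a map $Q_M\to Q_N$ (`exists_overHom_of_le`). -/

/-- In a finite rooted tree quiver, at most one arrow starts at each vertex. -/
theorem IsRootedTree.subsingleton_out {Λ : Type u'} [Quiver.{v'} Λ] [FiniteQuiver Λ] {σ : Λ}
    (hΛ : IsRootedTree Λ σ) (y : Λ) : Subsingleton (Σ z : Λ, (y ⟶ z)) := by
  have hloop : ∀ x : Λ, (x ⟶ x) → False := by
    intro x a
    have := hΛ.edge_unique x x
    exact Sum.inl_ne_inr (Subsingleton.elim (Sum.inl a : (x ⟶ x) ⊕ (x ⟶ x)) (Sum.inr a))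
  have : Fintype Λ := Fintype.ofFinite Λ
  let G := SimpleGraph.fromRel (ArrowRel Λ)
  let toEdge : (Σ x y : Λ, (x ⟶ y)) → G.edgeSet := fun e =>
    ⟨s(e.1, e.2.1), by
      rw [SimpleGraph.mem_edgeSet, SimpleGraph.fromRel_adj]
      refine ⟨fun h => ?_, Or.inl ⟨e.2.2⟩⟩
      obtain ⟨x, y, a⟩ := e
      obtain rfl : x = y := h
      exact hloop _ a⟩
  have hinj : Function.Injective toEdge := by
    rintro ⟨x, y, a⟩ ⟨x', y', a'⟩ h
    have h' : s(x, y) = s(x', y') := congrArg Subtype.val h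
    have := hΛ.edge_unique x y
    rcases Sym2.eq_iff.1 h' with ⟨rfl, rfl⟩ | ⟨rfl, rfl⟩
    · rw [Sum.inl_injective (Subsingleton.elim (Sum.inl a : (x ⟶ y) ⊕ (y ⟶ x)) (Sum.inl a'))]
    · exact absurd (Subsingleton.elim (Sum.inl a : (x ⟶ y) ⊕ (y ⟶ x)) (Sum.inr a')) Sum.inl_ne_inr
  have hout : ∀ x : {x : Λ // x ≠ σ}, ∃ y : Λ, Nonempty (x.1 ⟶ y) := by
    intro x
    by_contra h
    push Not at h
    exact x.2 ((hΛ.sink_iff x.1).1 h)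
  choose next hnext using hout
  let out : {x : Λ // x ≠ σ} → (Σ x y : Λ, (x ⟶ y)) := fun x => ⟨x.1, next x, (hnext x).some⟩
  have hout_inj : Function.Injective out := fun x x' h =>
    Subtype.ext (congrArg Sigma.fst h)
  have : Finite (Σ x y : Λ, (x ⟶ y)) := inferInstance
  have : Fintype (Σ x y : Λ, (x ⟶ y)) := Fintype.ofFinite _
  -- A tree has one edge fewer than vertices, so there are no more arrows than non-root vertices.
  -- The injection `out` is then a bijection, and every arrow is the chosen one at its tail.
  have hcard : Fintype.card (Σ x y : Λ, (x ⟶ y)) ≤ Fintype.card {x : Λ // x ≠ σ} := by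
    have h1 := Fintype.card_le_of_injective toEdge hinj
    have h2 := hΛ.isTree.card_edgeFinset
    rw [SimpleGraph.edgeFinset_card] at h2
    have h3 : Fintype.card {x : Λ // x ≠ σ} = Fintype.card Λ - 1 := by
      simp [Fintype.card_subtype_compl]
    have h4 : Fintype.card G.edgeSet + 1 = Fintype.card Λ := by convert h2
    omega
  have hsurj : Function.Surjective out :=
    ((Fintype.bijective_iff_injective_and_card out).2
      ⟨hout_inj, le_antisymm (Fintype.card_le_of_injective out hout_inj) hcard⟩).2
  refine ⟨?_⟩
  rintro ⟨z, b⟩ ⟨z', b'⟩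
  obtain ⟨p, hp⟩ := hsurj ⟨y, z, b⟩
  obtain ⟨p', hp'⟩ := hsurj ⟨y, z', b'⟩
  obtain rfl : p = p' :=
    Subtype.ext ((congrArg Sigma.fst hp).trans (congrArg Sigma.fst hp').symm)
  exact eq_of_heq (Sigma.mk.inj_iff.1 (hp.symm.trans hp')).2

/-! ### Pushforwards of the identity representation on standard basis vectors -/

section Pushforward

variable {Q : Type u} [Quiver.{v} Q] {Λ : Type u'} [Quiver.{v'} Λ]

/-- An arrow over `a` is determined by its tail, if at most one arrow starts at each vertex. -/
theorem ArrowFiber.eq_of_tail_eq {c : Λ ⥤q Q} (hc : ∀ y : Λ, Subsingleton (Σ z : Λ, (y ⟶ z)))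
    {s t : Q} {a : s ⟶ t} {b b' : ArrowFiber c a} (h : b.tail = b'.tail) : b = b' := by
  obtain ⟨⟨y, hy⟩, ⟨z, hz⟩, b, hb⟩ := b
  obtain ⟨⟨y', hy'⟩, ⟨z', hz'⟩, b', hb'⟩ := b'
  obtain rfl : y = y' := congrArg Subtype.val h
  have := (hc y).elim ⟨z, b⟩ ⟨z', b'⟩
  obtain ⟨rfl, h2⟩ := Sigma.mk.inj_iff.1 this
  obtain rfl := eq_of_heq h2
  rfl

/-- The image of an arrow over `a` under a map of quivers over `Q`. -/
def OverHom.onArrow {Γ : Type*} [Quiver Γ] {lam : Λ ⥤q Q} {gam : Γ ⥤q Q} (f : OverHom lam gam)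
    {s t : Q} {a : s ⟶ t} (b : ArrowFiber lam a) : ArrowFiber gam a where
  tail := f.onFiber b.tail
  head := f.onFiber b.head
  arrow := f.1.map b.arrow
  liesOver := by
    obtain ⟨f, rfl⟩ := f
    exact b.liesOver

variable (K : Type w) [Field K] [FiniteQuiver Λ] (c : Λ ⥤q Q)

theorem pushOne_map_stdVec {s t : Q} (a : s ⟶ t) (y : VertexFiber c s) :
    (pushOne K c).map a (stdVec K c y) =
      ∑ b : ArrowFiber c a, if b.tail = y then stdVec K c b.head else 0 := by
  simp only [LinearMap.coe_sum, Finset.sum_apply]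
  refine Finset.sum_congr rfl fun b _ => ?_
  simp only [stdVec, LinearMap.comp_apply, LinearMap.id_apply]
  split_ifs with h
  · subst h
    rw [DirectSum.component.lof_self]
  · rw [DirectSum.component.of, dif_neg (Ne.symm h), map_zero]

/-- With a unique arrow out of each vertex, only one summand of the pushforward map survives on a
basis vector. -/
theorem pushOne_map_stdVec_tail (hc : ∀ y : Λ, Subsingleton (Σ z : Λ, (y ⟶ z)))
    {s t : Q} {a : s ⟶ t} (b : ArrowFiber c a) :
    (pushOne K c).map a (stdVec K c b.tail) = stdVec K c b.head := by
  rw [pushOne_map_stdVec, Finset.sum_eq_single b]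
  · rw [if_pos rfl]
  · intro b' _ hb'
    rw [if_neg fun h => hb' (ArrowFiber.eq_of_tail_eq hc h)]
  · exact fun h => absurd (Finset.mem_univ b) h

theorem pushOne_map_stdVec_eq_zero {s t : Q} (a : s ⟶ t) (y : VertexFiber c s)
    (h : ∀ b : ArrowFiber c a, b.tail ≠ y) :
    (pushOne K c).map a (stdVec K c y) = 0 := by
  rw [pushOne_map_stdVec]
  exact Finset.sum_eq_zero fun b _ => if_neg (h b)

variable {K c}

theorem pushOne_hom_ext {x : Q} {W : Type*} [AddCommGroup W] [Module K W]
    {φ ψ : (pushOne K c).obj x →ₗ[K] W}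
    (h : ∀ y : VertexFiber c x, φ (stdVec K c y) = ψ (stdVec K c y)) : φ = ψ :=
  DirectSum.linearMap_ext K fun y => LinearMap.ext_ring (h y)

theorem stdVec_ne_zero {x : Q} (y : VertexFiber c x) : stdVec K c y ≠ 0 := by
  intro h
  have := congrArg (DirectSum.component K (VertexFiber c x) (fun _ => K) y) h
  rw [stdVec, DirectSum.component.lof_self, map_zero] at this
  exact one_ne_zero this

theorem OverHom.induced_stdVec {Γ : Type*} [Quiver Γ] [FiniteQuiver Γ] {gam : Γ ⥤q Q}
    (f : OverHom c gam) {x : Q} (y : VertexFiber c x) :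
    f.induced K x (stdVec K c y) = stdVec K gam (f.onFiber y) := by
  rw [OverHom.induced, stdVec, DirectSum.toModule_lof, LinearMap.toSpanSingleton_apply, one_smul]

/-- If at most one arrow starts at each vertex and `f` maps sinks to sinks, then `v_y ↦ w_{f(y)}`
is a morphism of representations. -/
theorem OverHom.induced_mem_repHom {Γ : Type*} [Quiver Γ] [FiniteQuiver Γ] {gam : Γ ⥤q Q}
    (hc : ∀ y : Λ, Subsingleton (Σ z : Λ, (y ⟶ z)))
    (hg : ∀ y : Γ, Subsingleton (Σ z : Γ, (y ⟶ z))) (f : OverHom c gam)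
    (hf : ∀ y : Λ, (∀ z, IsEmpty (y ⟶ z)) → ∀ z, IsEmpty (f.1.obj y ⟶ z)) :
    f.induced K ∈ RepHom (pushOne K c) (pushOne K gam) := by
  intro s t a
  refine pushOne_hom_ext fun y => ?_
  rw [LinearMap.comp_apply, LinearMap.comp_apply, f.induced_stdVec]
  by_cases h : ∃ b : ArrowFiber c a, b.tail = y
  · obtain ⟨b, rfl⟩ := h
    rw [pushOne_map_stdVec_tail K c hc b, f.induced_stdVec]
    exact pushOne_map_stdVec_tail K gam hg (f.onArrow b)
  · push Not at h
    rw [pushOne_map_stdVec_eq_zero K c a y h, map_zero]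
    -- An arrow `d` over `a` out of `f(y)` must be excluded when `y` has none. If `y` is a sink, so
    -- is `f(y)`. Otherwise the image of an arrow out of `y` must equal `d`, so that arrow already
    -- lay over `a`.
    refine pushOne_map_stdVec_eq_zero K gam a _ fun d hd => ?_
    obtain ⟨⟨_, hz⟩, ⟨z', hz'⟩, d, hda⟩ := d
    obtain ⟨y, hy⟩ := y
    obtain rfl := congrArg Subtype.val hd
    by_cases hy' : ∀ z, IsEmpty (y ⟶ z)
    · exact (hf y hy' z').false d
    · push Not at hy'
      obtain ⟨z, ⟨e⟩⟩ := hy'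
      obtain ⟨f, rfl⟩ := f
      obtain ⟨rfl, h2⟩ := Sigma.mk.inj_iff.1 ((hg (f.obj y)).elim ⟨_, f.map e⟩ ⟨z', d⟩)
      obtain rfl := eq_of_heq h2
      exact h ⟨⟨y, hy⟩, ⟨z, hz'⟩, e, hda⟩ rfl

end Pushforward

/-! ### Simulations between quivers over `Q` -/

section Simulation

variable {Q : Type u} [Quiver.{v} Q] {Λ : Type u'} [Quiver.{v'} Λ]

/-- The arrow of `Q` under an arrow of `Λ`, with its ends. -/
def baseArrow (c : Λ ⥤q Q) {y z : Λ} (e : y ⟶ z) : Σ s t : Q, (s ⟶ t) :=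
  ⟨c.obj y, c.obj z, c.map e⟩

theorem arrow_sigma_ext {s t s' t' : Q} (hs : s = s') (ht : t = t') {a : s ⟶ t} {a' : s' ⟶ t'}
    (h : a ≍ a') : (⟨s, t, a⟩ : Σ s t : Q, (s ⟶ t)) = ⟨s', t', a'⟩ := by
  subst hs ht
  rw [eq_of_heq h]

/-- A relation between the vertices of two quivers over `Q` along which arrows lift backwards. -/
def IsSimulation {Γ : Type*} [Quiver Γ] (lam : Λ ⥤q Q) (gam : Γ ⥤q Q) (R : Λ → Γ → Prop) : Prop :=
  ∀ ⦃y y' : Λ⦄ (e : y ⟶ y') ⦃z' : Γ⦄, R y' z' →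
    ∃ (z : Γ) (d : z ⟶ z'), baseArrow gam d = baseArrow lam e ∧ R y z

/-- The pairs `(y, z)` such that `w_z` has a nonzero coefficient in `φ(v_y)` form a simulation. -/
theorem isSimulation_of_mem_repHom {K : Type w} [Field K] [FiniteQuiver Λ] {Γ : Type*} [Quiver Γ]
    [FiniteQuiver Γ] {lam : Λ ⥤q Q} {gam : Γ ⥤q Q}
    (hc : ∀ y : Λ, Subsingleton (Σ z : Λ, (y ⟶ z)))
    {φ : ∀ x : Q, (pushOne K lam).obj x →ₗ[K] (pushOne K gam).obj x}
    (hφ : φ ∈ RepHom (pushOne K lam) (pushOne K gam)) :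
    IsSimulation lam gam fun y z => ∃ h : gam.obj z = lam.obj y,
      DirectSum.component K (VertexFiber gam (lam.obj y)) (fun _ => K) ⟨z, h⟩
        (φ (lam.obj y) (stdVec K lam ⟨y, rfl⟩)) ≠ 0 := by
  rintro y y' e z' ⟨hz', hne⟩
  let b : ArrowFiber lam (lam.map e) := ⟨⟨y, rfl⟩, ⟨y', rfl⟩, e, rfl⟩
  have h1 : stdVec K lam (⟨y', rfl⟩ : VertexFiber lam (lam.obj y')) =
      (pushOne K lam).map (lam.map e) (stdVec K lam ⟨y, rfl⟩) :=
    (pushOne_map_stdVec_tail K lam hc b).symm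
  have h2 := LinearMap.congr_fun (hφ _ _ (lam.map e)) (stdVec K lam ⟨y, rfl⟩)
  rw [LinearMap.comp_apply, LinearMap.comp_apply] at h2
  rw [h1, ← h2] at hne
  simp only [LinearMap.coe_sum, Finset.sum_apply, map_sum, LinearMap.comp_apply,
    LinearMap.id_apply] at hne
  -- The coefficient of `z'` is a sum over the arrows over `lam.map e`. A nonzero term comes from an
  -- arrow with head `z'` whose tail lies in the support of `φ(v_y)`.
  obtain ⟨d, -, hd⟩ := Finset.exists_ne_zero_of_sum_ne_zero hne
  rw [DirectSum.component.of] at hd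
  split_ifs at hd with hdz
  swap
  · exact absurd rfl hd
  obtain ⟨⟨z, hz⟩, ⟨z'', hz''⟩, d, hda⟩ := d
  obtain rfl : z'' = z' := congrArg Subtype.val hdz
  refine ⟨z, d, ?_, hz, ?_⟩
  · simp only [baseArrow]
    rw [Quiver.Hom.cast_eq_iff_heq] at hda
    exact arrow_sigma_ext hz hz'' hda
  · intro h0
    apply hd
    exact h0

end Simulation

/-! ### Glued quivers -/

section Glue

variable {Q : Type u} [Quiver.{v} Q]

theorem glue_str_map_toRoot {x : Q} {ι : Type (max u v)} [Finite ι] {y : ι → Q}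
    (a : ∀ i, y i ⟶ x) (F : ∀ i, PointedOver Q (y i)) (i : ι) :
    (glue a F).str.map (X := some ⟨i, (F i).root⟩) (Y := none) (GlueHom.toRoot i) ≍ a i :=
  Quiver.Hom.cast_heq (F i).str_root.symm rfl (a i)

/-- Both properties travel together: the new arrow at the root of a piece is its only outgoing arrow
because that root had none inside the piece. -/
theorem glue_out {x : Q} {ι : Type (max u v)} [Finite ι] {y : ι → Q} (a : ∀ i, y i ⟶ x)
    (F : ∀ i, PointedOver Q (y i)) (hroot : ∀ i z, IsEmpty ((F i).root ⟶ z))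
    (hout : ∀ (i) (y : (F i).V), y ≠ (F i).root → Nonempty (Unique (Σ z, (y ⟶ z)))) :
    (∀ z, IsEmpty ((glue a F).root ⟶ z)) ∧
      ∀ y, y ≠ (glue a F).root → Nonempty (Unique (Σ z, (y ⟶ z))) := by
  constructor
  · refine fun z => ⟨fun e => ?_⟩
    change GlueHom _ _ none z at e
    cases e
  · rintro (_ | ⟨i, p⟩) hp
    · exact absurd rfl hp
    · by_cases h : p = (F i).root
      · subst h
        refine ⟨⟨⟨⟨none, .toRoot i⟩⟩, ?_⟩⟩
        rintro ⟨z, e⟩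
        change GlueHom (fun i => (F i).V) (fun i => (F i).root) (some ⟨i, (F i).root⟩) z at e
        cases e with
        | incl i e => exact ((hroot i _).false e).elim
        | toRoot i => rfl
      · obtain ⟨U⟩ := hout i p h
        refine ⟨⟨⟨⟨some ⟨i, U.default.1⟩, .incl i U.default.2⟩⟩, ?_⟩⟩
        rintro ⟨z, e⟩
        change GlueHom (fun i => (F i).V) (fun i => (F i).root) (some ⟨i, p⟩) z at e
        cases e with
        | @incl _ _ z e =>
          exact congrArg (fun s : Σ z, (p ⟶ z) => (⟨some ⟨i, s.1⟩, GlueHom.incl i s.2⟩ :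
            Σ z, GlueHom (fun i => (F i).V) (fun i => (F i).root) (some ⟨i, p⟩) z)) (U.uniq ⟨z, e⟩)
        | toRoot i => exact absurd rfl h

/-- A simulation between glued quivers that relates the roots also relates the root of each piece
to the root of a piece attached by the same arrow, and restricts to a simulation of these pieces. -/
theorem IsSimulation.of_glue {x : Q} {ι : Type (max u v)} [Finite ι] {y : ι → Q}
    {a : ∀ i, y i ⟶ x} {F : ∀ i, PointedOver Q (y i)}
    {ι' : Type (max u v)} [Finite ι'] {y' : ι' → Q} {a' : ∀ i, y' i ⟶ x}
    {G : ∀ i, PointedOver Q (y' i)} {R : (glue a F).V → (glue a' G).V → Prop}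
    (hR : IsSimulation (glue a F).str (glue a' G).str R)
    (hroot : R (glue a F).root (glue a' G).root) (i : ι) :
    ∃ j : ι', (⟨y' j, a' j⟩ : Σ y : Q, (y ⟶ x)) = ⟨y i, a i⟩ ∧
      ∃ R' : (F i).V → (G j).V → Prop, IsSimulation (F i).str (G j).str R' ∧
        R' (F i).root (G j).root := by
  -- Only the added arrows end at the new root, so lifting the arrow of piece `i` selects a piece
  -- `j` and relates the two old roots.
  obtain ⟨z, d, hd, hz⟩ := hR (y := some ⟨i, (F i).root⟩) (GlueHom.toRoot i) hroot
  change GlueHom (fun i => (G i).V) (fun i => (G i).root) z none at d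
  cases d with
  | toRoot j =>
    refine ⟨j, ?_, fun p q => R (some ⟨i, p⟩) (some ⟨j, q⟩), ?_, hz⟩
    · obtain ⟨h1, h2⟩ := Sigma.mk.inj_iff.1 hd
      have h1' : y' j = y i := (G j).str_root.symm.trans (h1.trans (F i).str_root)
      change (G j).str.obj (G j).root = (F i).str.obj (F i).root at h1
      -- The tails of the arrows in `hd` are the images of the old roots, which agree with `y' j`
      -- and `y i` only propositionally. The casts are compared first and then removed.
      have h3 : Quiver.Hom.cast (G j).str_root.symm rfl (a' j) ≍
          Quiver.Hom.cast (F i).str_root.symm rfl (a i) := by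
        have key : ∀ {s s' : Q} (hs : s = s') {b : s ⟶ x} {b' : s' ⟶ x},
            (⟨x, b⟩ : Σ t : Q, (s ⟶ t)) ≍ (⟨x, b'⟩ : Σ t : Q, (s' ⟶ t)) → b ≍ b' := by
          rintro s _ rfl b b' h
          exact (Sigma.mk.inj_iff.1 (eq_of_heq h)).2
        exact key h1 h2
      exact Sigma.ext h1' ((Quiver.Hom.cast_heq _ _ _).symm.trans
        (h3.trans (Quiver.Hom.cast_heq _ _ _)))
    · intro p p' e q' hq'
      -- An arrow whose head lies in piece `j` has its tail there too, so lifts never leave the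
      -- piece.
      obtain ⟨z, d, hd, hz⟩ := hR (y := some ⟨i, p⟩) (GlueHom.incl i e) hq'
      change GlueHom (fun i => (G i).V) (fun i => (G i).root) z (some ⟨j, q'⟩) at d
      cases d with
      | @incl _ q _ d => exact ⟨q, d, hd, hz⟩

/-- Root preserving maps of quivers over `Q` between pieces attached by the same arrows define a
root preserving map between glued quivers. -/
theorem exists_overHom_glue {x : Q} {P : Type (max u v)} {A B : P → Type (max u v)}
    [Finite (Σ p, A p)] [Finite (Σ p, B p)] {y : P → Q} (a : ∀ p, y p ⟶ x)
    (F : ∀ i : Σ p, A p, PointedOver Q (y i.1)) (G : ∀ i : Σ p, B p, PointedOver Q (y i.1))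
    (h : ∀ i : Σ p, A p, ∃ (j : B i.1) (f : OverHom (F i).str (G ⟨i.1, j⟩).str),
      f.1.obj (F i).root = (G ⟨i.1, j⟩).root) :
    ∃ f : OverHom (glue (fun i : Σ p, A p => a i.1) F).str
        (glue (fun i : Σ p, B p => a i.1) G).str,
      f.1.obj (glue (fun i : Σ p, A p => a i.1) F).root =
        (glue (fun i : Σ p, B p => a i.1) G).root := by
  choose j f hf using h
  let obj : (glue (fun i : Σ p, A p => a i.1) F).V → (glue (fun i : Σ p, B p => a i.1) G).V :=
    fun p => match p with
      | none => none
      | some ⟨i, p⟩ => some ⟨⟨i.1, j i⟩, (f i).1.obj p⟩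
  -- Stated for any `r` equal to the root, since `f i` sends root to root only propositionally.
  have toRoot : ∀ (k : Σ p, B p) (r : (G k).V), r = (G k).root →
      ∃ d : GlueHom (fun i => (G i).V) (fun i => (G i).root) (some ⟨k, r⟩) none,
        (glue (fun i : Σ p, B p => a i.1) G).str.map (X := some ⟨k, r⟩) (Y := none) d ≍ a k.1 := by
    rintro k _ rfl
    exact ⟨.toRoot k, glue_str_map_toRoot _ G k⟩
  have hobj : ∀ p, (glue (fun i : Σ p, B p => a i.1) G).str.obj (obj p) =
      (glue (fun i : Σ p, A p => a i.1) F).str.obj p := by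
    rintro (_ | ⟨i, p⟩)
    · rfl
    · exact congrArg (fun H : (F i).V ⥤q Q => H.obj p) (f i).2
  have hmap : ∀ (p q : (glue (fun i : Σ p, A p => a i.1) F).V) (e : p ⟶ q),
      ∃ d : obj p ⟶ obj q, (glue (fun i : Σ p, B p => a i.1) G).str.map d ≍
        (glue (fun i : Σ p, A p => a i.1) F).str.map e := by
    intro p q e
    change GlueHom (fun i => (F i).V) (fun i => (F i).root) p q at e
    cases e with
    | incl i e =>
      refine ⟨GlueHom.incl (V := fun i => (G i).V) (r := fun i => (G i).root) (⟨i.1, j i⟩ : Σ p, B p)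
        ((f i).1.map e), ?_⟩
      have key : ∀ {H H' : (F i).V ⥤q Q}, H = H' → H.map e ≍ H'.map e := by
        rintro H _ rfl
        rfl
      exact key (f i).2
    | toRoot i =>
      obtain ⟨d, hd⟩ := toRoot ⟨i.1, j i⟩ _ (hf i)
      exact ⟨d, hd.trans (glue_str_map_toRoot (fun i : Σ p, A p => a i.1) F i).symm⟩
  choose map hmap using hmap
  refine ⟨⟨⟨obj, fun {p q} e => map p q e⟩, ?_⟩, rfl⟩
  refine Prefunctor.ext hobj fun p q e => eq_of_heq ?_
  refine (hmap p q e).trans ?_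
  have key : ∀ {s t s' t' : Q} (hs : s = s') (ht : t = t') (b : s ⟶ t),
      b ≍ (Eq.recOn ht (Eq.recOn hs b : s' ⟶ t) : s' ⟶ t') := by
    rintro s t _ _ rfl rfl b
    rfl
  exact key (hobj p).symm (hobj q).symm _

end Glue

/-! ### Reduced quivers -/

section Reduced

variable {Q : Type u} [Quiver.{v} Q] [FiniteQuiver Q]

theorem reducedAux_out {x : Q} (h : Acc (ArrowRel Q) x) (M : lattAux h) :
    (∀ z, IsEmpty ((reducedAux h M).root ⟶ z)) ∧
      ∀ y, y ≠ (reducedAux h M).root → Nonempty (Unique (Σ z, (y ⟶ z))) := by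
  induction h with
  | intro x h ih =>
    exact glue_out _ _ (fun i => (ih i.1.1 ⟨i.1.2⟩ i.2.1).1) fun i => (ih i.1.1 ⟨i.1.2⟩ i.2.1).2

theorem reducedAux_subsingleton_out {x : Q} (h : Acc (ArrowRel Q) x) (M : lattAux h)
    (y : (reducedAux h M).V) : Subsingleton (Σ z, (y ⟶ z)) := by
  by_cases hy : y = (reducedAux h M).root
  · subst hy
    exact ⟨fun p => (((reducedAux_out h M).1 p.1).false p.2).elim⟩
  · obtain ⟨U⟩ := (reducedAux_out h M).2 y hy
    exact U.instSubsingleton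

/-- Arrows of $Q_M$ point towards the root, so their images form a nonempty path to `x`. As `x` is
accessible it lies on no cycle, which keeps the other vertices off the fibre over `x`. -/
theorem transGen_str_obj {x : Q} (h : Acc (ArrowRel Q) x) (M : lattAux h)
    (z : (reducedAux h M).V) (hz : z ≠ (reducedAux h M).root) :
    Relation.TransGen (ArrowRel Q) ((reducedAux h M).str.obj z) x := by
  induction h with
  | intro x h ih =>
    obtain _ | ⟨i, z⟩ := z
    · exact absurd rfl hz
    · have hi : ArrowRel Q i.1.1 x := ⟨i.1.2⟩
      by_cases hzi : z = (reducedAux (h i.1.1 hi) i.2.1).root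
      · subst hzi
        refine .single ?_
        have := (reducedAux (h i.1.1 hi) i.2.1).str_root
        rw [← this] at hi
        exact hi
      · exact .tail (ih i.1.1 hi i.2.1 z hzi) hi

/-- The root is the only vertex of `Q_M` over `x`. -/
theorem eq_root_of_str_obj_eq {x : Q} (h : Acc (ArrowRel Q) x) (M : lattAux h)
    (z : (reducedAux h M).V) (hz : (reducedAux h M).str.obj z = x) :
    z = (reducedAux h M).root := by
  by_contra hne
  have h1 := transGen_str_obj h M z hne
  rw [hz] at h1
  have irrefl : ∀ y, Acc (Relation.TransGen (ArrowRel Q)) y →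
      ¬ Relation.TransGen (ArrowRel Q) y y := by
    intro y hy
    induction hy with
    | intro y _ ih => exact fun hyy => ih y hyy hyy
  exact irrefl x h.transGen h1

theorem exists_le_maximal_mem {A : Type*} [PartialOrder A] [Finite A] (I : LowerSet A) {S : A}
    (hS : S ∈ I) : ∃ T, S ≤ T ∧ Maximal (fun T => T ∈ I) T :=
  (Set.toFinite {T | T ∈ I}).exists_le_maximal hS

/-- Ideals are determined by their maximal elements. The simulation matches each piece $Q_{S'}$ with
a piece $Q_T$ over the same arrow, and induction gives $S'\le T$. -/
theorem le_of_isSimulation {x : Q} (h : Acc (ArrowRel Q) x) (M N : lattAux h)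
    {R : (reducedAux h M).V → (reducedAux h N).V → Prop}
    (hR : IsSimulation (reducedAux h M).str (reducedAux h N).str R)
    (hroot : R (reducedAux h M).root (reducedAux h N).root) : M ≤ N := by
  induction h with
  | intro x h ih =>
    intro p S hS
    change S ∈ (M p : LowerSet _) at hS
    -- Only maximal elements index pieces, so `S` is replaced by a maximal element above it.
    obtain ⟨S', hSS', hS'⟩ := exists_le_maximal_mem (A := lattAux (h p.1 ⟨p.2⟩)) (M p) hS
    obtain ⟨⟨p', T, hT⟩, hp, R', hR', hroot'⟩ := hR.of_glue hroot ⟨p, S', hS'⟩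
    obtain rfl : p' = p := hp
    exact (N p').lower (hSS'.trans (ih p'.1 ⟨p'.2⟩ S' T hR' hroot')) hT.prop

/-- A maximal `S` of `M p` lies in `N p`, hence below some maximal `T`. The maps $Q_S\to Q_T$
supplied by `ih` are glued at the new roots. -/
theorem exists_overHom_reducedAux_intro {x : Q} (h : ∀ y, ArrowRel Q y x → Acc (ArrowRel Q) y)
    (M N : ∀ p : (Σ y : Q, (y ⟶ x)), LowerSet (lattAux (h p.1 ⟨p.2⟩))) (hMN : M ≤ N)
    (ih : ∀ (p : Σ y : Q, (y ⟶ x)) (S T : lattAux (h p.1 ⟨p.2⟩)), S ≤ T →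
      ∃ f : OverHom (reducedAux (h p.1 ⟨p.2⟩) S).str (reducedAux (h p.1 ⟨p.2⟩) T).str,
        f.1.obj (reducedAux (h p.1 ⟨p.2⟩) S).root = (reducedAux (h p.1 ⟨p.2⟩) T).root) :
    ∃ f : OverHom (reducedAux (Acc.intro x h) M).str (reducedAux (Acc.intro x h) N).str,
      f.1.obj (reducedAux (Acc.intro x h) M).root = (reducedAux (Acc.intro x h) N).root := by
  refine exists_overHom_glue (P := Σ y : Q, (y ⟶ x))
    (A := fun p => {S : lattAux (h p.1 ⟨p.2⟩) // Maximal (fun T => T ∈ M p) S})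
    (B := fun p => {S : lattAux (h p.1 ⟨p.2⟩) // Maximal (fun T => T ∈ N p) S})
    (y := Sigma.fst) (fun p => p.2) (fun i => reducedAux (h i.1.1 ⟨i.1.2⟩) i.2.1)
    (fun i => reducedAux (h i.1.1 ⟨i.1.2⟩) i.2.1) ?_
  rintro ⟨p, S, hS⟩
  obtain ⟨T, hST, hT⟩ := exists_le_maximal_mem (N p) (hMN p hS.prop)
  obtain ⟨f, hf⟩ := ih p S T hST
  exact ⟨⟨T, hT⟩, f, hf⟩

theorem exists_overHom_of_le {x : Q} (h : Acc (ArrowRel Q) x) (M N : lattAux h) (hMN : M ≤ N) :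
    ∃ f : OverHom (reducedAux h M).str (reducedAux h N).str,
      f.1.obj (reducedAux h M).root = (reducedAux h N).root := by
  induction h with
  | intro x h ih =>
    exact exists_overHom_reducedAux_intro h M N hMN fun p => ih p.1 ⟨p.2⟩

end Reduced

/-! ### Stable hom spaces of reduced representations -/

theorem mk_eq_zero_iff {K : Type w} [Field K] {Q : Type u} [Quiver.{v} Q] {V W : Rep K Q}
    {x : Q} (φ : RepHom V W) :
    (Submodule.Quotient.mk φ : StableHom V W x) = 0 ↔ φ.1 x = 0 := by
  rw [Submodule.Quotient.mk_eq_zero]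
  rfl

section StableHom

variable {Q : Type u} [Quiver.{v} Q] [FiniteQuiver Q] {σ : Q} {hQ : IsRootedTree Q σ} {x : Q}

/-- The root of `Q_M`, as a vertex over `x`. -/
def rootFiber (M : Latt hQ x) : VertexFiber (reducedStr M) x :=
  ⟨(reducedQuiver M).root, (reducedQuiver M).str_root⟩

theorem eq_rootFiber (M : Latt hQ x) (y : VertexFiber (reducedStr M) x) : y = rootFiber M :=
  Subtype.ext (eq_root_of_str_obj_eq _ M y.1 y.2)

/-- Root preservation is automatic between reduced quivers, because the target has only one vertex
over `x`. -/
theorem OverHom.onFiber_rootFiber {M N : Latt hQ x} (f : OverHom (reducedStr M) (reducedStr N)) :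
    f.onFiber (rootFiber M) = rootFiber N :=
  eq_rootFiber N _

theorem induced_mem_repHom_reducedRep (K : Type w) [Field K] {M N : Latt hQ x}
    (f : OverHom (reducedStr M) (reducedStr N)) :
    f.induced K ∈ RepHom (reducedRep K M) (reducedRep K N) := by
  refine f.induced_mem_repHom (reducedAux_subsingleton_out _ M)
    (reducedAux_subsingleton_out _ N) fun y hy => ?_
  by_cases h : y = (reducedQuiver M).root
  · have := congrArg Subtype.val f.onFiber_rootFiber
    subst h
    change f.1.obj (reducedQuiver M).root = (reducedQuiver N).root at this
    rw [this]
    exact (reducedAux_out _ N).1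
  · obtain ⟨U⟩ := (reducedAux_out _ M).2 y h
    exact ((hy U.default.1).false U.default.2).elim

theorem eq_coeff_smul_stdVec_root {K : Type w} [Field K] {M : Latt hQ x}
    (v : (reducedRep K M).obj x) :
    v = DirectSum.component K (VertexFiber (reducedStr M) x) (fun _ => K) (rootFiber M) v •
      stdVec K (reducedStr M) (rootFiber M) := by
  refine DirectSum.ext_component K fun y => ?_
  obtain rfl := eq_rootFiber M y
  rw [map_smul, stdVec, DirectSum.component.lof_self, smul_eq_mul, mul_one]

/-- Since both spaces at `x` are lines spanned by the roots, `φ x ≠ 0` says exactly that the support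
of `φ` relates the roots. -/
theorem le_of_mem_repHom {K : Type w} [Field K] {M N : Latt hQ x}
    {φ : ∀ z : Q, (reducedRep K M).obj z →ₗ[K] (reducedRep K N).obj z}
    (hφ : φ ∈ RepHom (reducedRep K M) (reducedRep K N)) (hx : φ x ≠ 0) : M ≤ N := by
  refine le_of_isSimulation _ M N
    (isSimulation_of_mem_repHom (reducedAux_subsingleton_out _ M) hφ)
    ⟨(reducedQuiver N).str_root.trans (reducedQuiver M).str_root.symm, fun h0 => hx ?_⟩
  -- The simulation uses the fibre over the image of the root; a variable `s` transports the
  -- vanishing coefficient to the fibre over `x`.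
  have key : ∀ {s : Q} (hs : (reducedQuiver M).str.obj (reducedQuiver M).root = s)
      (h : (reducedQuiver N).str.obj (reducedQuiver N).root = s),
      DirectSum.component K (VertexFiber (reducedStr N) s) (fun _ => K)
        ⟨(reducedQuiver N).root, h⟩ (φ s (stdVec K (reducedStr M)
          ⟨(reducedQuiver M).root, hs⟩)) = 0 := by
    rintro _ rfl h
    exact h0
  refine pushOne_hom_ext fun y => ?_
  obtain rfl := eq_rootFiber M y
  rw [eq_coeff_smul_stdVec_root (φ x _)]
  erw [key (reducedQuiver M).str_root (reducedQuiver N).str_root]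
  simp

theorem mk_induced_ne_zero (K : Type w) [Field K] {M N : Latt hQ x}
    (f : OverHom (reducedStr M) (reducedStr N)) :
    (Submodule.Quotient.mk ⟨f.induced K, induced_mem_repHom_reducedRep K f⟩ :
      StableHom (reducedRep K M) (reducedRep K N) x) ≠ 0 := by
  rw [Ne, mk_eq_zero_iff]
  intro h
  have := LinearMap.congr_fun h (stdVec K (reducedStr M) (rootFiber M))
  rw [f.induced_stdVec] at this
  exact stdVec_ne_zero _ this

/-- At `x` the map induced by `f` sends one spanning vector to the other, so any `φ` agrees there
with a multiple of it. The scalar is the coefficient of `φ` at the roots. -/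
theorem mk_eq_smul_mk_induced {K : Type w} [Field K] {M N : Latt hQ x}
    (f : OverHom (reducedStr M) (reducedStr N)) (φ : RepHom (reducedRep K M) (reducedRep K N)) :
    ∃ r : K, (Submodule.Quotient.mk φ : StableHom (reducedRep K M) (reducedRep K N) x) =
      r • Submodule.Quotient.mk ⟨f.induced K, induced_mem_repHom_reducedRep K f⟩ := by
  refine ⟨DirectSum.component K (VertexFiber (reducedStr N) x) (fun _ => K) (rootFiber N)
    (φ.1 x (stdVec K (reducedStr M) (rootFiber M))), ?_⟩
  rw [← Submodule.Quotient.mk_smul, ← sub_eq_zero, ← Submodule.Quotient.mk_sub, mk_eq_zero_iff]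
  refine pushOne_hom_ext fun y => ?_
  obtain rfl := eq_rootFiber M y
  have h := f.induced_stdVec (K := K) (rootFiber M)
  rw [f.onFiber_rootFiber] at h
  have h2 := eq_coeff_smul_stdVec_root (φ.1 x (stdVec K (reducedStr M) (rootFiber M)))
  rw [← h] at h2
  exact sub_eq_zero.2 h2

end StableHom

end QuiverOver

end

/-! ### Induced morphisms, surjectivity onto the stable hom space, and the order criterion -/

theorem theorem3 (K : Type*) [Field K] (Q : Type*) [Quiver Q] [QuiverOver.FiniteQuiver Q] (σ : Q)
    (hQ : QuiverOver.IsRootedTree Q σ) :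
    (∀ (Λ : Type*) [Quiver Λ] [QuiverOver.FiniteQuiver Λ] (σΛ : Λ)
        (_ : QuiverOver.IsRootedTree Λ σΛ)
        (Γ : Type*) [Quiver Γ] [QuiverOver.FiniteQuiver Γ] (σΓ : Γ)
        (_ : QuiverOver.IsRootedTree Γ σΓ)
        (lam : Λ ⥤q Q) (gam : Γ ⥤q Q) (f : QuiverOver.OverHom lam gam),
        f.1.obj σΛ = σΓ →
          lam.obj σΛ = gam.obj σΓ ∧
          QuiverOver.OverHom.induced K f ∈
            QuiverOver.RepHom (QuiverOver.pushOne K lam) (QuiverOver.pushOne K gam) ∧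
          QuiverOver.OverHom.induced K f (lam.obj σΛ) ≠ 0) ∧
    (∀ (x : Q) (M N : QuiverOver.Latt hQ x),
      (∃ Φ : (QuiverOver.OverHom (QuiverOver.reducedStr M) (QuiverOver.reducedStr N) →₀ K) →ₗ[K]
            QuiverOver.StableHom (QuiverOver.reducedRep K M) (QuiverOver.reducedRep K N) x,
        (∀ f : QuiverOver.OverHom (QuiverOver.reducedStr M) (QuiverOver.reducedStr N),
          ∃ hf : QuiverOver.OverHom.induced K f ∈
              QuiverOver.RepHom (QuiverOver.reducedRep K M) (QuiverOver.reducedRep K N),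
            Φ (Finsupp.single f 1) = Submodule.Quotient.mk ⟨QuiverOver.OverHom.induced K f, hf⟩) ∧
        Function.Surjective Φ) ∧
      (Nontrivial
          (QuiverOver.StableHom (QuiverOver.reducedRep K M) (QuiverOver.reducedRep K N) x) ↔
        M ≤ N)) := by
  refine ⟨?_, fun x M N => ⟨⟨Finsupp.linearCombination K fun f => Submodule.Quotient.mk
    ⟨QuiverOver.OverHom.induced K f, QuiverOver.induced_mem_repHom_reducedRep K f⟩, fun f =>
      ⟨QuiverOver.induced_mem_repHom_reducedRep K f, ?_⟩, fun q => ?_⟩, ?_, fun hMN => ?_⟩⟩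
  · intro Λ _ _ σΛ hΛ Γ _ _ σΓ hΓ lam gam f hf
    refine ⟨?_, f.induced_mem_repHom hΛ.subsingleton_out hΓ.subsingleton_out fun y hy => ?_,
      fun h => ?_⟩
    · exact ((f.onFiber ⟨σΛ, rfl⟩).2.symm).trans (congrArg gam.obj hf)
    · obtain rfl := (hΛ.sink_iff y).1 hy
      exact (hΓ.sink_iff _).2 hf
    · have := LinearMap.congr_fun h (QuiverOver.stdVec K lam ⟨σΛ, rfl⟩)
      rw [f.induced_stdVec] at this
      exact QuiverOver.stdVec_ne_zero _ this
  · rw [Finsupp.linearCombination_single, one_smul]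
  · obtain ⟨φ, rfl⟩ := Submodule.Quotient.mk_surjective _ q
    -- There may be no map $Q_M\to Q_N$ at all; the zero class is then still hit by `0`. A nonzero
    -- class produces a map, and one multiple of it suffices.
    by_cases hφ : φ.1 x = 0
    · exact ⟨0, by rw [map_zero, (QuiverOver.mk_eq_zero_iff φ).2 hφ]⟩
    · obtain ⟨f, -⟩ := QuiverOver.exists_overHom_of_le _ M N
        (QuiverOver.le_of_mem_repHom φ.2 hφ)
      obtain ⟨r, hr⟩ := QuiverOver.mk_eq_smul_mk_induced f φ
      exact ⟨Finsupp.single f r, by rw [Finsupp.linearCombination_single, hr]⟩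
  · intro h
    obtain ⟨q, hq⟩ := exists_ne (0 : QuiverOver.StableHom (QuiverOver.reducedRep K M)
      (QuiverOver.reducedRep K N) x)
    obtain ⟨φ, rfl⟩ := Submodule.Quotient.mk_surjective _ q
    exact QuiverOver.le_of_mem_repHom φ.2 fun h0 => hq ((QuiverOver.mk_eq_zero_iff φ).2 h0)
  · obtain ⟨f, -⟩ := QuiverOver.exists_overHom_of_le _ M N hMN
    exact nontrivial_of_ne _ _ (QuiverOver.mk_induced_ne_zero K f)
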